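/- Let $p,q\ge 0$ and $m\ge 1$ be integers, $n=p+q$, and let $\mathbf K$ be $\mathbf R$, $\mathbf C$ or the quaternions $\mathbf H$. Let $\mathbf B=\{V_1,\dots,V_n\}$ be a basis of one-vectors for $\mathrm{Cl}(p,q)$ consisting of $m\times m$ matrices over $\mathbf K$, that is, $V_i^2=I$ for $i\le p$, $V_i^2=-I$ for $i>p$, and $V_iV_j=-V_jV_i$ for $i\neq j$. The assignment of $V_i$ to the $i$-th generator represents the Clifford algebra $\mathrm{Cl}(p,q)$ by matrices; a one-vector is a real linear combination of the $V_i$. Assume * **BP1**: $V_i^*=\pm V_i$ for each $i$ (sign depending on $i$), where $*$ is the conjugate transpose; * **BP2**: for all $i\ne j$, $\operatorname{Tr}(V_i^*V_j)=0$ if $\mathbf K=\mathbf R$ or $\mathbf C$, and $\operatorname{Re}\operatorname{Tr}(V_i^*V_j)=0$ if $\mathbf K=\mathbf H$. Let $\mathrm{Spin}^+(p,q)$ be the connected component of the identity in the set of all matrices which represent an even element $x$ of $\mathrm{Cl}(p,q)$ such that $xx^{cc}=1$ and $xvx^{cc}$ is a one-vector for every one-vector $v$; here $x^{cc}$ is the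 Clifford conjugate (grade involution followed by reversion) of $x$. Let $\Phi_{p,q}$ send $Y\in\mathrm{Spin}^+(p,q)$ to the real $n\times n$ matrix, with respect to the basis $\mathbf B$, of the linear map $v\mapsto YvY^{cc}$ on the space of one-vectors. Let $SO^+(p,q)$ be the connected component of the identity in $SO(p,q)=\{X\in M(n,\mathbf R): X^TI_{p,q}X=I_{p,q},\ \det X=1\}$, where $I_{p,q}=I_p\oplus(-I_q)$. Then for every (symmetric) positive definite $P\in SO^+(p,q)$ there is exactly one positive definite $Y\in\mathrm{Spin}^+(p,q)$ with $\Phi_{p,q}(Y)=P$. Here a matrix $Y$ over $\mathbf K$ is positive definite if $Y^*=Y$ and $x^*Yx>0$ for every nonzero column vector $x\in\mathbf K^m$. -/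

import Mathlib

open scoped Matrix Quaternion ComplexOrder

noncomputable section

/-- The group `SO(p, q)`: real matrices `X` with `Xᵀ I_{p,q} X = I_{p,q}` and `det X = 1`, where
`I_{p,q}` is the diagonal matrix with `p` entries `1` followed by `q` entries `-1`. Rows and columns
are indexed by `Fin p ⊕ Fin q`. -/
def specialIndefinite (p q : ℕ) : Set (Matrix (Fin p ⊕ Fin q) (Fin p ⊕ Fin q) ℝ) :=
  {X | Xᵀ * LieAlgebra.Orthogonal.indefiniteDiagonal (Fin p) (Fin q) ℝ * X =
      LieAlgebra.Orthogonal.indefiniteDiagonal (Fin p) (Fin q) ℝ ∧ X.det = 1}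

/-- The group `SO⁺(p, q)`: the connected component of the identity in `SO(p, q)`. -/
def specialIndefinitePlus (p q : ℕ) : Set (Matrix (Fin p ⊕ Fin q) (Fin p ⊕ Fin q) ℝ) :=
  connectedComponentIn (specialIndefinite p q) 1

/-- The signs of the signature `(p, q)`: `1` on the first `p` indices, `-1` on the last `q`. -/
def sigSign (p q : ℕ) : Fin p ⊕ Fin q → ℝ :=
  Sum.elim (fun _ => 1) (fun _ => -1)

/-- The quadratic form `x₁² + ⋯ + x_p² - x_{p+1}² - ⋯ - x_{p+q}²`. -/
def sigForm (p q : ℕ) : QuadraticForm ℝ (Fin p ⊕ Fin q → ℝ) :=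
  QuadraticMap.weightedSumSquares ℝ (sigSign p q)

/-- The abstract Clifford algebra `Cl(p, q)`. -/
abbrev Cl (p q : ℕ) : Type := CliffordAlgebra (sigForm p q)

namespace Cl

variable {p q : ℕ}

/-- Clifford conjugation `x ↦ x^cc`: grade involution followed by reversion. -/
def cc (x : Cl p q) : Cl p q :=
  CliffordAlgebra.reverse (CliffordAlgebra.involute x)

/-- The elements `x` of `Cl(p, q)` that are even, satisfy `x x^cc = 1`, and are such that
`x v x^cc` is a one-vector for every one-vector `v`. Its identity component is `Spin⁺(p, q)`. -/
def spinSet (p q : ℕ) : Set (Cl p q) :=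
  {x | CliffordAlgebra.involute x = x ∧ x * cc x = 1 ∧
    ∀ v, ∃ w, x * CliffordAlgebra.ι (sigForm p q) v * cc x = CliffordAlgebra.ι (sigForm p q) w}

end Cl

/-- A basis of one-vectors for `Cl(p, q)` that consists of `m × m` matrices over `K`: the first `p`
matrices square to `I`, the last `q` square to `-I`, and distinct ones anticommute. -/
structure OneVectorBasis (K : Type) [Ring K] (p q m : ℕ) where
  /-- The matrices of the basis. -/
  vec : Fin p ⊕ Fin q → Matrix (Fin m) (Fin m) K
  sq_pos : ∀ i : Fin p, vec (Sum.inl i) * vec (Sum.inl i) = 1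
  sq_neg : ∀ j : Fin q, vec (Sum.inr j) * vec (Sum.inr j) = -1
  anticomm : ∀ i j, i ≠ j → vec i * vec j = -(vec j * vec i)

namespace OneVectorBasis

variable {K : Type} [Ring K] {p q m : ℕ}

/-- Each basis element is Hermitian or skew-Hermitian. -/
def BP1 [Star K] (B : OneVectorBasis K p q m) : Prop :=
  ∀ i, (B.vec i)ᴴ = B.vec i ∨ (B.vec i)ᴴ = -B.vec i

/-- Distinct basis elements are orthogonal for the trace inner product `Tr (U* V)`; used for real
and complex matrices. -/
def BP2 [Star K] (B : OneVectorBasis K p q m) : Prop :=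
  ∀ i j, i ≠ j → ((B.vec i)ᴴ * B.vec j).trace = 0

/-- Distinct basis elements are orthogonal for `Re (Tr (U* V))`; used for quaternionic matrices. -/
def BP2Quaternion (B : OneVectorBasis ℍ[ℝ] p q m) : Prop :=
  ∀ i j, i ≠ j → ((B.vec i)ᴴ * B.vec j).trace.re = 0

variable [Algebra ℝ K]

/-- The one-vector with given coordinates with respect to the basis. -/
def comb (B : OneVectorBasis K p q m) : (Fin p ⊕ Fin q → ℝ) →ₗ[ℝ] Matrix (Fin m) (Fin m) K :=
  Fintype.linearCombination ℝ B.vec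

theorem vec_sq (B : OneVectorBasis K p q m) (i : Fin p ⊕ Fin q) :
    B.vec i * B.vec i = sigSign p q i • (1 : Matrix (Fin m) (Fin m) K) := by
  rcases i with i | i
  · simp [sigSign, B.sq_pos]
  · simp [sigSign, B.sq_neg]

theorem vec_polar (B : OneVectorBasis K p q m) (i j : Fin p ⊕ Fin q) :
    B.vec i * B.vec j + B.vec j * B.vec i =
      (if i = j then 2 * sigSign p q i else 0) • (1 : Matrix (Fin m) (Fin m) K) := by
  by_cases h : i = j
  · subst h
    rw [vec_sq, if_pos rfl, ← add_smul, two_mul]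
  · rw [B.anticomm i j h, if_neg h, zero_smul, neg_add_cancel]

theorem comb_polar (B : OneVectorBasis K p q m) (c : Fin p ⊕ Fin q → ℝ) (j : Fin p ⊕ Fin q) :
    B.comb c * B.vec j + B.vec j * B.comb c =
      (2 * sigSign p q j * c j) • (1 : Matrix (Fin m) (Fin m) K) := by
  simp only [comb, Fintype.linearCombination_apply, Finset.sum_mul, Finset.mul_sum,
    ← Finset.sum_add_distrib, smul_mul_assoc, mul_smul_comm, ← smul_add, vec_polar, smul_smul]
  rw [← Finset.sum_smul]
  congr 1
  rw [Finset.sum_eq_single j]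
  · simp only [if_true]; ring
  · intro b _ hb
    simp [hb]
  · simp

theorem comb_sq (B : OneVectorBasis K p q m) (c : Fin p ⊕ Fin q → ℝ) :
    B.comb c * B.comb c = algebraMap ℝ (Matrix (Fin m) (Fin m) K) (sigForm p q c) := by
  have h2 : (2 : ℝ) • (B.comb c * B.comb c) =
      (2 : ℝ) • algebraMap ℝ (Matrix (Fin m) (Fin m) K) (sigForm p q c) := by
    have h : B.comb c * B.comb c + B.comb c * B.comb c =
        ∑ j, c j • (B.comb c * B.vec j + B.vec j * B.comb c) := by
      simp only [smul_add, Finset.sum_add_distrib, ← mul_smul_comm, ← Finset.mul_sum]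
      simp only [mul_smul_comm, ← smul_mul_assoc, ← Finset.sum_mul]
      simp only [comb, Fintype.linearCombination_apply]
    rw [two_smul, h]
    simp only [comb_polar, smul_smul, ← Finset.sum_smul, Algebra.algebraMap_eq_smul_one]
    congr 1
    simp only [sigForm, QuadraticMap.weightedSumSquares_apply, Finset.mul_sum, smul_eq_mul]
    exact Finset.sum_congr rfl fun j _ => by ring
  exact smul_right_injective _ (two_ne_zero : (2 : ℝ) ≠ 0) h2

/-- The algebra homomorphism from the abstract `Cl(p, q)` to matrices that sends the `i`-th
generator to the `i`-th matrix of the basis. Its range is `Cl(p, q)` as an algebra of matrices. -/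
def rep (B : OneVectorBasis K p q m) : Cl p q →ₐ[ℝ] Matrix (Fin m) (Fin m) K :=
  CliffordAlgebra.lift (sigForm p q) ⟨B.comb, B.comb_sq⟩

/-- The space of one-vectors: real linear combinations of the matrices of the basis. -/
def oneVectors (B : OneVectorBasis K p q m) : Submodule ℝ (Matrix (Fin m) (Fin m) K) :=
  Submodule.span ℝ (Set.range B.vec)

theorem rep_ι (B : OneVectorBasis K p q m) (c : Fin p ⊕ Fin q → ℝ) :
    B.rep (CliffordAlgebra.ι (sigForm p q) c) = B.comb c := by
  simp [rep]

theorem mem_oneVectors (B : OneVectorBasis K p q m) (v : Matrix (Fin m) (Fin m) K) :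
    v ∈ B.oneVectors ↔ ∃ c, B.comb c = v := by
  rw [oneVectors, ← Fintype.range_linearCombination, LinearMap.mem_range]
  rfl

theorem linearIndependent [Nontrivial K] [NeZero m] (B : OneVectorBasis K p q m) :
    LinearIndependent ℝ B.vec := by
  rw [Fintype.linearIndependent_iff]
  intro c hc j
  have h := B.comb_polar c j
  have h0 : B.comb c = 0 := by rw [comb, Fintype.linearCombination_apply, hc]
  rw [h0, zero_mul, mul_zero, add_zero, eq_comm, smul_eq_zero] at h
  rcases h with h | h
  · rcases j with j | j <;> simpa [sigSign] using h
  · exact absurd h one_ne_zero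

/-- The matrices `X₁, …, X_{p+q}` as a basis of the space of one-vectors. -/
def basis [Nontrivial K] [NeZero m] (B : OneVectorBasis K p q m) :
    Module.Basis (Fin p ⊕ Fin q) ℝ B.oneVectors :=
  Module.Basis.span B.linearIndependent

variable [TopologicalSpace K]

/-- The group `Spin⁺(p, q)` as a set of matrices: the connected component of the identity in the
set of matrices that represent even `x` with `x x^cc = 1` that preserve one-vectors. -/
def spinPlus (B : OneVectorBasis K p q m) : Set (Matrix (Fin m) (Fin m) K) :=
  connectedComponentIn (B.rep '' Cl.spinSet p q) 1

theorem exists_lift (B : OneVectorBasis K p q m) (Y : B.spinPlus) :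
    ∃ x ∈ Cl.spinSet p q, B.rep x = Y := by
  have h : (Y : Matrix (Fin m) (Fin m) K) ∈ B.rep '' Cl.spinSet p q :=
    connectedComponentIn_subset _ _ Y.2
  exact h

/-- The Clifford conjugate `Y^cc`, as a matrix, of a matrix `Y` in `Spin⁺(p, q)`. It does not depend
on the element of the abstract algebra that represents `Y`, see `conj_eq`. -/
def conj (B : OneVectorBasis K p q m) (Y : B.spinPlus) : Matrix (Fin m) (Fin m) K :=
  B.rep (Cl.cc (B.exists_lift Y).choose)

theorem mul_conj (B : OneVectorBasis K p q m) (Y : B.spinPlus) :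
    (Y : Matrix (Fin m) (Fin m) K) * B.conj Y = 1 := by
  obtain ⟨h1, h2⟩ := (B.exists_lift Y).choose_spec
  have h := congrArg B.rep h1.2.1
  rwa [map_mul, map_one, h2] at h

theorem conj_eq [IsStablyFiniteRing K] (B : OneVectorBasis K p q m) (Y : B.spinPlus) (x : Cl p q)
    (hx : x ∈ Cl.spinSet p q) (hxY : B.rep x = Y) : B.conj Y = B.rep (Cl.cc x) := by
  have h := congrArg B.rep hx.2.1
  rw [map_mul, map_one, hxY, mul_eq_one_comm] at h
  exact (left_inv_eq_right_inv h (B.mul_conj Y)).symm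

theorem conj_mem (B : OneVectorBasis K p q m) (Y : B.spinPlus) (v : B.oneVectors) :
    (Y : Matrix (Fin m) (Fin m) K) * v * B.conj Y ∈ B.oneVectors := by
  obtain ⟨h1, h2⟩ := (B.exists_lift Y).choose_spec
  obtain ⟨c, hc⟩ := (B.mem_oneVectors v).1 v.2
  obtain ⟨w, hw⟩ := h1.2.2 c
  refine (B.mem_oneVectors _).2 ⟨w, ?_⟩
  have h := congrArg B.rep hw
  rw [map_mul, map_mul, h2, rep_ι, rep_ι, hc] at h
  exact h.symm

/-- The linear map `v ↦ Y v Y^cc` on one-vectors, for `Y` in `Spin⁺(p, q)`. -/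
def spinAct (B : OneVectorBasis K p q m) (Y : B.spinPlus) : B.oneVectors →ₗ[ℝ] B.oneVectors where
  toFun v := ⟨Y * v * B.conj Y, B.conj_mem Y v⟩
  map_add' v w := by ext1; simp [mul_add, add_mul]
  map_smul' r v := by ext1; simp

/-- The covering map `Φ_{p,q}`: it sends `Y` in `Spin⁺(p, q)` to the matrix of `v ↦ Y v Y^cc` with
respect to the chosen basis of one-vectors. -/
def covering [Nontrivial K] [NeZero m] (B : OneVectorBasis K p q m) (Y : B.spinPlus) :
    Matrix (Fin p ⊕ Fin q) (Fin p ⊕ Fin q) ℝ :=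
  LinearMap.toMatrix B.basis B.basis (B.spinAct Y)

end OneVectorBasis

/-- Positive definiteness of a quaternionic matrix: it is Hermitian and `x* X x > 0` for all nonzero
quaternionic column vectors `x` (this number is real as `X` is Hermitian). -/
def QuaternionPosDef {m : ℕ} (X : Matrix (Fin m) (Fin m) ℍ[ℝ]) : Prop :=
  X.IsHermitian ∧ ∀ x : Fin m → ℍ[ℝ], x ≠ 0 → 0 < (star x ⬝ᵥ X *ᵥ x).re

end

/-!
Uniqueness. If `Y₁` and `Y₂` have the same image under the covering, `Z = Y₂⁻¹ Y₁` represents an even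
element and commutes with every one-vector. Averaging a Clifford element over the conjugations by
the generators does not change its image under the representation when that image commutes with the
one-vectors, and it kills every even monomial in the generators except the scalars
(`Cl.exists_avgAll_eq_smul_one`). So `Z` is a real scalar, and as averaging commutes with Clifford
conjugation, `Z Z^cc = 1` forces `Z = ±1` (`OneVectorBasis.rep_eq_one_or_neg_one`). Of `Y₂` and `-Y₂`
only one is positive definite.

Existence. Diagonalising `P` gives a symmetric `A` with `exp A = P` and `I_{p,q} A = -A I_{p,q}`
(`Matrix.PosDef.exists_log`). It is the adjoint action on one-vectors of the bivector
`x = ¼ ∑ A i j e_i e_j⁻¹` (`Cl.bivector_comm_ι`), so `exp x` lies in the spin group, is joined to `1`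
by the path `exp (t x)`, and acts on one-vectors as `exp A = P`. The condition on the adjoints makes
the first `p` matrices of the basis Hermitian and the last `q` skew-Hermitian. As only products of
one of each occur in `x`, the matrix of `x` is Hermitian and that of `exp x` is
`Z* Z` with `Z` the matrix of `exp (x / 2)`.

The Clifford algebra carries no topology, so its exponential `algExp` is taken in the left regular
representation. Identities are moved from powers to exponentials by linear maps (`map_algExp_eq`).
-/

noncomputable section

/-! ### The exponential in a finite-dimensional real algebra -/

section AlgExp

variable {A : Type*} [Ring A] [Algebra ℝ A] [Module.Finite ℝ A]

theorem hasSum_matrix_exp {n : Type*} [Fintype n] [DecidableEq n] (M : Matrix n n ℝ) :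
    HasSum (fun k : ℕ => ((k.factorial : ℝ)⁻¹) • M ^ k) (NormedSpace.exp M) := by
  open scoped Matrix.Norms.Operator in
  exact NormedSpace.exp_series_hasSum_exp' (𝕂 := ℝ) M

theorem continuous_matrix_exp_smul {n : Type*} [Fintype n] [DecidableEq n] (M : Matrix n n ℝ) :
    Continuous fun t : ℝ => NormedSpace.exp (t • M) := by
  open scoped Matrix.Norms.Operator in
  exact (NormedSpace.exp_continuous (𝔸 := Matrix n n ℝ)).comp (continuous_id.smul continuous_const)

variable (A) in
/-- The left regular representation of a finite-dimensional algebra by real matrices. -/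
def leftReg : A →ₐ[ℝ] Matrix (Fin (Module.finrank ℝ A)) (Fin (Module.finrank ℝ A)) ℝ :=
  Algebra.leftMulMatrix (Module.finBasis ℝ A)

theorem leftReg_injective : Function.Injective (leftReg A) :=
  Algebra.leftMulMatrix_injective _

theorem exists_leftReg_eq_exp (x : A) : ∃ y, leftReg A y = NormedSpace.exp (leftReg A x) := by
  have hc : IsClosed ((LinearMap.range (leftReg A).toLinearMap : Submodule ℝ _) : Set
      (Matrix (Fin (Module.finrank ℝ A)) (Fin (Module.finrank ℝ A)) ℝ)) :=
    Submodule.closed_of_finiteDimensional _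
  have hmem := hc.mem_of_tendsto (hasSum_matrix_exp (leftReg A x))
    (Filter.Eventually.of_forall fun s => Submodule.sum_mem _ fun k _ =>
      Submodule.smul_mem _ _ ⟨x ^ k, by simp⟩)
  exact hmem

/-- The exponential in a finite-dimensional real algebra that carries no topology. It is obtained
from the matrix exponential through the left regular representation, whose range is closed. -/
def algExp (x : A) : A := (exists_leftReg_eq_exp x).choose

theorem leftReg_algExp (x : A) : leftReg A (algExp x) = NormedSpace.exp (leftReg A x) :=
  (exists_leftReg_eq_exp x).choose_spec

theorem exists_comp_leftReg {F : Type*} [AddCommGroup F] [Module ℝ F] (f : A →ₗ[ℝ] F) :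
    ∃ g : Matrix (Fin (Module.finrank ℝ A)) (Fin (Module.finrank ℝ A)) ℝ →ₗ[ℝ] F,
      ∀ a, g (leftReg A a) = f a := by
  obtain ⟨r, hr⟩ := LinearMap.exists_leftInverse_of_injective (leftReg A).toLinearMap
    (LinearMap.ker_eq_bot.2 leftReg_injective)
  exact ⟨f ∘ₗ r, fun a => congrArg f (LinearMap.congr_fun hr a)⟩

theorem hasSum_map_algExp {F : Type*} [AddCommGroup F] [Module ℝ F] [TopologicalSpace F]
    [IsTopologicalAddGroup F] [ContinuousSMul ℝ F] (f : A →ₗ[ℝ] F) (x : A) :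
    HasSum (fun k : ℕ => ((k.factorial : ℝ)⁻¹) • f (x ^ k)) (f (algExp x)) := by
  obtain ⟨g, hg⟩ := exists_comp_leftReg f
  have h := (hasSum_matrix_exp (leftReg A x)).map g (LinearMap.continuous_of_finiteDimensional g)
  rw [← leftReg_algExp, hg] at h
  convert h using 2 with k
  simp [← map_pow, hg]

/-- Linear maps that agree on powers agree on exponentials. This transfers identities
from powers to exponentials without a topology on the target. -/
theorem map_algExp_eq {A' F : Type*} [Ring A'] [Algebra ℝ A'] [Module.Finite ℝ A']
    [AddCommGroup F] [Module ℝ F] (f : A →ₗ[ℝ] F) (g : A' →ₗ[ℝ] F) (x : A) (z : A')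
    (h : ∀ k : ℕ, f (x ^ k) = g (z ^ k)) : f (algExp x) = g (algExp z) := by
  refine (Module.forall_dual_apply_eq_zero_iff ℝ _).1 (fun φ => ?_) |> sub_eq_zero.1
  have h1 := hasSum_map_algExp (φ ∘ₗ f) x
  have h2 := hasSum_map_algExp (φ ∘ₗ g) z
  simp only [LinearMap.comp_apply, h] at h1 h2
  rw [map_sub, h1.unique h2, sub_self]

theorem algExp_add_of_commute {x y : A} (h : Commute x y) :
    algExp (x + y) = algExp x * algExp y := by
  apply leftReg_injective
  rw [map_mul, leftReg_algExp, leftReg_algExp, leftReg_algExp, map_add]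
  exact Matrix.exp_add_of_commute _ _ (h.map (leftReg A))

theorem algExp_zero : algExp (0 : A) = 1 := by
  apply leftReg_injective
  rw [leftReg_algExp, map_zero, NormedSpace.exp_zero, map_one]

theorem algExp_mul_neg (x : A) : algExp x * algExp (-x) = 1 := by
  rw [← algExp_add_of_commute (Commute.neg_right (Commute.refl x)), add_neg_cancel, algExp_zero]

theorem continuous_map_algExp_smul {F : Type*} [AddCommGroup F] [Module ℝ F] [TopologicalSpace F]
    [IsTopologicalAddGroup F] [ContinuousSMul ℝ F] (f : A →ₗ[ℝ] F) (x : A) :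
    Continuous fun t : ℝ => f (algExp (t • x)) := by
  obtain ⟨g, hg⟩ := exists_comp_leftReg f
  have h := (LinearMap.continuous_of_finiteDimensional g).comp
    (continuous_matrix_exp_smul (leftReg A x))
  convert h using 2 with t
  rw [Function.comp_apply, ← map_smul, ← leftReg_algExp, hg]

theorem algExp_matrix {n : Type*} [Fintype n] [DecidableEq n] (M : Matrix n n ℝ) :
    algExp M = NormedSpace.exp M := by
  have h := hasSum_map_algExp (LinearMap.id : Matrix n n ℝ →ₗ[ℝ] Matrix n n ℝ) M
  simp only [LinearMap.id_apply] at h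
  exact h.unique (hasSum_matrix_exp M)

theorem algExp_mulLeft (x : A) :
    algExp (A := Module.End ℝ A) (LinearMap.mulLeft ℝ x) = LinearMap.mulLeft ℝ (algExp x) := by
  refine (map_algExp_eq (F := Module.End ℝ A) (LinearMap.mul ℝ A) LinearMap.id x _ fun k => ?_).symm
  exact (LinearMap.pow_mulLeft ℝ A x k).symm

theorem algExp_mulRight (x : A) :
    algExp (A := Module.End ℝ A) (LinearMap.mulRight ℝ x) = LinearMap.mulRight ℝ (algExp x) := by
  refine (map_algExp_eq (F := Module.End ℝ A) (LinearMap.mul ℝ A).flip LinearMap.id x _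
    fun k => ?_).symm
  exact (LinearMap.pow_mulRight ℝ A x k).symm

theorem algExp_apply_of_intertwine {V W : Type*} [AddCommGroup V] [Module ℝ V] [Module.Finite ℝ V]
    [AddCommGroup W] [Module ℝ W] [Module.Finite ℝ W] (j : V →ₗ[ℝ] W) (C : Module.End ℝ V)
    (D : Module.End ℝ W) (h : ∀ v, D (j v) = j (C v)) (v : V) :
    algExp D (j v) = j (algExp C v) := by
  have hpow : ∀ k : ℕ, ∀ w, (D ^ k) (j w) = j ((C ^ k) w) := by
    intro k
    induction k with
    | zero => simp
    | succ k ih =>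
      intro w
      rw [pow_succ, pow_succ, Module.End.mul_apply, Module.End.mul_apply, ← ih, ← h]
  exact map_algExp_eq (A := Module.End ℝ W) (A' := Module.End ℝ V) (F := W)
    (LinearMap.applyₗ (j v)) (j ∘ₗ LinearMap.applyₗ v) D C fun k => hpow k v

/-- If `ad x = [x, ·]` acts as `C` on the image of `j`, then conjugation by `exp x` acts as
`exp C`: this is the identity `Ad (exp x) = exp (ad x)`. -/
theorem algExp_mul_mul_algExp_neg {V : Type*} [AddCommGroup V] [Module ℝ V] [Module.Finite ℝ V]
    (x : A) (j : V →ₗ[ℝ] A) (C : Module.End ℝ V) (h : ∀ v, x * j v - j v * x = j (C v)) (v : V) :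
    algExp x * j v * algExp (-x) = j (algExp C v) := by
  have hlr : Commute (LinearMap.mulLeft ℝ x : Module.End ℝ A) (LinearMap.mulRight ℝ (-x)) :=
    LinearMap.ext fun a => by simp [mul_assoc]
  have key := algExp_apply_of_intertwine j C
    (LinearMap.mulLeft ℝ x + LinearMap.mulRight ℝ (-x) : Module.End ℝ A)
    (fun v => by rw [← h, LinearMap.add_apply]; simp [sub_eq_add_neg]) v
  rw [← key, algExp_add_of_commute hlr, algExp_mulLeft, algExp_mulRight]
  simp [mul_assoc]

end AlgExp

/-! ### Monomials in the generators of `Cl(p, q)` -/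

namespace Cl

variable {p q : ℕ}

/-- Counting in lists over a sum type uses its derived Boolean equality. -/
instance : LawfulBEq (Fin p ⊕ Fin q) where
  rfl {a} := by rcases a with a | a <;> exact beq_self_eq_true a
  eq_of_beq {a b} h := by
    rcases a with a | a <;> rcases b with b | b
    · exact congrArg Sum.inl (eq_of_beq (α := Fin p) h)
    · exact absurd h Bool.false_ne_true
    · exact absurd h Bool.false_ne_true
    · exact congrArg Sum.inr (eq_of_beq (α := Fin q) h)

theorem sigSign_mul_self (i : Fin p ⊕ Fin q) : sigSign p q i * sigSign p q i = 1 := by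
  rcases i with i | i <;> simp [sigSign]

/-- The `i`-th generator of `Cl(p, q)`. -/
def gen (i : Fin p ⊕ Fin q) : Cl p q := CliffordAlgebra.ι (sigForm p q) (Pi.single i 1)

theorem gen_mul_self (i : Fin p ⊕ Fin q) : gen i * gen i = sigSign p q i • (1 : Cl p q) := by
  rw [gen, CliffordAlgebra.ι_sq_scalar, Algebra.algebraMap_eq_smul_one]
  congr 1
  rw [show sigForm p q = QuadraticMap.weightedSumSquares ℝ (sigSign p q) from rfl,
    QuadraticMap.weightedSumSquares_apply, Finset.sum_eq_single i]
  · simp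
  · intro b _ hb
    simp [hb]
  · simp

theorem gen_mul_gen {i j : Fin p ⊕ Fin q} (h : i ≠ j) : gen i * gen j = -(gen j * gen i) := by
  refine CliffordAlgebra.ι_mul_ι_comm_of_isOrtho ?_
  rw [QuadraticMap.isOrtho_def]
  simp only [sigForm, QuadraticMap.weightedSumSquares_apply, ← Finset.sum_add_distrib]
  refine Finset.sum_congr rfl fun k _ => ?_
  by_cases hi : k = i
  · subst hi
    simp [h]
  · simp [hi]

theorem ι_eq_sum_gen (v : Fin p ⊕ Fin q → ℝ) :
    CliffordAlgebra.ι (sigForm p q) v = ∑ i, v i • gen i := by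
  conv_lhs => rw [pi_eq_sum_univ' v, map_sum]
  refine Finset.sum_congr rfl fun i _ => ?_
  rw [map_smul, gen]

/-- The product of the generators with indices in a list. -/
def mon (L : List (Fin p ⊕ Fin q)) : Cl p q := (L.map gen).prod

@[simp]
theorem mon_nil : mon ([] : List (Fin p ⊕ Fin q)) = 1 := rfl

@[simp]
theorem mon_cons (i : Fin p ⊕ Fin q) (L : List (Fin p ⊕ Fin q)) :
    mon (i :: L) = gen i * mon L := by
  simp [mon]

theorem mon_append (L L' : List (Fin p ⊕ Fin q)) : mon (L ++ L') = mon L * mon L' := by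
  simp [mon]

theorem mon_perm {L L' : List (Fin p ⊕ Fin q)} (h : L.Perm L') :
    mon L = mon L' ∨ mon L = -mon L' := by
  induction h with
  | nil => simp
  | cons i _ ih => rcases ih with ih | ih <;> simp [ih]
  | swap i j L =>
    by_cases hij : i = j
    · simp [hij]
    · right
      rw [mon_cons, mon_cons, mon_cons, mon_cons, ← mul_assoc, gen_mul_gen (Ne.symm hij), neg_mul,
        mul_assoc]
  | trans _ _ ih1 ih2 => rcases ih1 with h1 | h1 <;> rcases ih2 with h2 | h2 <;> simp [h1, h2]

/-- Up to sign, equal factors of a monomial can be cancelled in pairs. -/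
theorem exists_nodup_mon (L : List (Fin p ⊕ Fin q)) :
    ∃ L' : List (Fin p ⊕ Fin q), L'.Nodup ∧ (∀ i, Even (L.count i) ↔ Even (L'.count i)) ∧
      (mon L = mon L' ∨ mon L = -mon L') := by
  induction L with
  | nil => exact ⟨[], by simp⟩
  | cons i L ih =>
    obtain ⟨L', hn, hc, hm⟩ := ih
    by_cases hi : i ∈ L'
    · have hp := List.perm_cons_erase hi
      refine ⟨L'.erase i, hn.erase i, fun k => ?_, ?_⟩
      · have hk := hp.count_eq k
        have hck := hc k
        rw [List.count_cons] at hk ⊢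
        rw [hk] at hck
        simp only [Nat.even_add] at hck ⊢
        tauto
      · have h1 : mon (i :: i :: L'.erase i) = mon (L'.erase i) ∨
            mon (i :: i :: L'.erase i) = -mon (L'.erase i) := by
          rw [mon_cons, mon_cons, ← mul_assoc, gen_mul_self]
          rcases i with i | i <;> simp [sigSign]
        have h2 : mon (i :: L) = mon (i :: i :: L'.erase i) ∨
            mon (i :: L) = -mon (i :: i :: L'.erase i) := by
          rw [mon_cons i L, mon_cons i (i :: _)]
          rcases hm with hm | hm <;> rcases mon_perm hp with h | h <;> simp [hm, h]
        rcases h1 with h1 | h1 <;> rcases h2 with h2 | h2 <;> simp [h1, h2]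
    · refine ⟨i :: L', hn.cons hi, fun k => ?_, ?_⟩
      · simp only [List.count_cons, Nat.even_add, hc k]
      · rcases hm with h | h <;> simp [h]

theorem mon_eq_one_of_even_count {L : List (Fin p ⊕ Fin q)} (h : ∀ i, Even (L.count i)) :
    mon L = 1 ∨ mon L = -1 := by
  obtain ⟨L', hn, hc, hm⟩ := exists_nodup_mon L
  have hL' : L' = [] := by
    refine List.eq_nil_iff_forall_not_mem.2 fun i hi => ?_
    have := (hc i).1 (h i)
    rw [List.count_eq_one_of_mem hn hi] at this
    exact absurd this (by decide)
  simpa [hL'] using hm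

theorem span_mon : Submodule.span ℝ (Set.range (mon : List (Fin p ⊕ Fin q) → Cl p q)) = ⊤ := by
  rw [eq_top_iff]
  intro x _
  have hmul : ∀ a b : Cl p q, a ∈ Submodule.span ℝ (Set.range mon) →
      b ∈ Submodule.span ℝ (Set.range mon) → a * b ∈ Submodule.span ℝ (Set.range mon) := by
    intro a b ha hb
    have h := Submodule.mul_mem_mul ha hb
    rw [Submodule.span_mul_span] at h
    refine Submodule.span_mono ?_ h
    rintro _ ⟨_, ⟨L, rfl⟩, _, ⟨L', rfl⟩, rfl⟩
    exact ⟨L ++ L', mon_append L L'⟩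
  induction x using CliffordAlgebra.induction with
  | algebraMap r =>
    rw [Algebra.algebraMap_eq_smul_one]
    exact Submodule.smul_mem _ _ (Submodule.subset_span ⟨[], rfl⟩)
  | ι v =>
    rw [ι_eq_sum_gen]
    exact Submodule.sum_mem _ fun i _ =>
      Submodule.smul_mem _ _ (Submodule.subset_span ⟨[i], by simp⟩)
  | mul a b ha hb => exact hmul a b (ha trivial) (hb trivial)
  | add a b ha hb => exact Submodule.add_mem _ (ha trivial) (hb trivial)

instance : Module.Finite ℝ (Cl p q) := by
  have hfin : (Set.range fun L : {L : List (Fin p ⊕ Fin q) // L.Nodup} => mon L.1).Finite :=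
    Set.finite_range _
  refine ⟨?_⟩
  have htop : Submodule.span ℝ (Set.range fun L : {L : List (Fin p ⊕ Fin q) // L.Nodup} =>
      mon L.1) = ⊤ := by
    rw [eq_top_iff, ← span_mon, Submodule.span_le]
    rintro _ ⟨L, rfl⟩
    obtain ⟨L', hn, -, hm⟩ := exists_nodup_mon L
    have hL' := Submodule.subset_span (R := ℝ)
      (Set.mem_range_self (f := fun L : {L : List (Fin p ⊕ Fin q) // L.Nodup} => mon L.1) ⟨L', hn⟩)
    rcases hm with hm | hm <;> rw [SetLike.mem_coe, hm]
    · exact hL'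
    · exact Submodule.neg_mem _ hL'
  rw [← htop]
  exact Submodule.fg_span hfin

theorem involute_gen (i : Fin p ⊕ Fin q) : CliffordAlgebra.involute (gen i) = -gen i :=
  CliffordAlgebra.involute_ι _

theorem cc_gen (i : Fin p ⊕ Fin q) : cc (gen i) = -gen i := by
  simp [cc, gen]

theorem cc_mul (x y : Cl p q) : cc (x * y) = cc y * cc x := by
  simp [cc]

theorem involute_mon (L : List (Fin p ⊕ Fin q)) :
    CliffordAlgebra.involute (mon L) = (-1 : ℝ) ^ L.length • mon L := by
  induction L with
  | nil => simp
  | cons i L ih => simp [ih, involute_gen, pow_succ]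

theorem gen_mul_mon (i : Fin p ⊕ Fin q) (L : List (Fin p ⊕ Fin q)) :
    gen i * mon L = (-1 : ℝ) ^ (L.length + L.count i) • (mon L * gen i) := by
  induction L with
  | nil => simp
  | cons j L ih =>
    by_cases h : j = i
    · subst h
      rw [mon_cons]
      conv_lhs => rw [ih, mul_smul_comm, ← mul_assoc]
      congr 1
      rw [List.length_cons, List.count_cons_self, ← add_assoc, add_right_comm _ 1, add_assoc _ 1,
        pow_add _ _ 2]
      simp
    · rw [mon_cons, ← mul_assoc, gen_mul_gen (Ne.symm h), neg_mul, mul_assoc, ih, mul_smul_comm,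
        List.length_cons, List.count_cons_of_ne h, add_right_comm, pow_succ, ← mul_assoc]
      simp

/-! ### Averaging over conjugations by the generators -/

/-- The mean of `x` and its conjugate by the `i`-th generator `e`; here `s • e` with `s = e²`
is the inverse of `e`. -/
def avg (i : Fin p ⊕ Fin q) : Module.End ℝ (Cl p q) :=
  (2⁻¹ : ℝ) • (LinearMap.id + sigSign p q i •
    (LinearMap.mulLeft ℝ (gen i) ∘ₗ LinearMap.mulRight ℝ (gen i)))

theorem avg_apply (i : Fin p ⊕ Fin q) (x : Cl p q) :
    avg i x = (2⁻¹ : ℝ) • (x + sigSign p q i • (gen i * (x * gen i))) := rfl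

/-- A monomial of even degree is fixed or killed, as it commutes or anticommutes with the `i`-th
generator, and this depends on the parity of the multiplicity of `i`. -/
theorem avg_mon (i : Fin p ⊕ Fin q) {L : List (Fin p ⊕ Fin q)} (hL : Even L.length) :
    avg i (mon L) = if Even (L.count i) then mon L else 0 := by
  rw [avg_apply, ← mul_assoc, gen_mul_mon, smul_mul_assoc, mul_assoc, gen_mul_self, mul_smul_comm,
    mul_one, pow_add, hL.neg_one_pow, one_mul, smul_comm (sigSign p q i), smul_smul (sigSign p q i),
    sigSign_mul_self, one_smul]
  split_ifs with h
  · rw [h.neg_one_pow, one_smul, ← two_smul ℝ, smul_smul]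
    norm_num
  · rw [(Nat.not_even_iff_odd.1 h).neg_one_pow]
    simp

theorem avg_cc (i : Fin p ⊕ Fin q) (x : Cl p q) : avg i (cc x) = cc (avg i x) := by
  have h : cc (gen i * (x * gen i)) = gen i * (cc x * gen i) := by
    simp [cc_mul, cc_gen, mul_assoc]
  rw [avg_apply, avg_apply, ← h]
  simp [cc]

/-- The composition of the averages over all generators. -/
def avgAll : Module.End ℝ (Cl p q) := ((Finset.univ.toList).map avg).prod

theorem avgAll_cc (x : Cl p q) : avgAll (cc x) = cc (avgAll x) := by
  unfold avgAll
  induction (Finset.univ : Finset (Fin p ⊕ Fin q)).toList with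
  | nil => simp
  | cons i J ih => simp [ih, avg_cc]

theorem prod_avg_mon (J : List (Fin p ⊕ Fin q)) {L : List (Fin p ⊕ Fin q)} (hL : Even L.length) :
    (J.map avg).prod (mon L) = if ∀ i ∈ J, Even (L.count i) then mon L else 0 := by
  induction J with
  | nil => simp
  | cons i J ih =>
    rw [List.map_cons, List.prod_cons, Module.End.mul_apply, ih]
    by_cases hJ : ∀ k ∈ J, Even (L.count k)
    · rw [if_pos hJ, avg_mon i hL]
      by_cases hi : Even (L.count i)
      · rw [if_pos hi, if_pos (by simpa [hi] using hJ)]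
      · rw [if_neg hi, if_neg fun h => hi (h i (by simp))]
    · rw [if_neg hJ, map_zero, if_neg fun h => hJ fun k hk => h k (by simp [hk])]

/-- Averaging over the generators projects the even part onto the scalars: a monomial of even degree
survives only if every generator occurs in it an even number of times. -/
theorem exists_avgAll_eq_smul_one {x : Cl p q} (hx : CliffordAlgebra.involute x = x) :
    ∃ r : ℝ, avgAll x = r • (1 : Cl p q) := by
  have hspan : ∀ y : Cl p q, avgAll (y + CliffordAlgebra.involute y) ∈
      Submodule.span ℝ {(1 : Cl p q)} := by
    intro y
    have hy : y ∈ Submodule.span ℝ (Set.range (mon : List (Fin p ⊕ Fin q) → Cl p q)) := by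
      rw [span_mon]
      trivial
    induction hy using Submodule.span_induction with
    | mem y h =>
      obtain ⟨L, rfl⟩ := h
      rw [involute_mon]
      by_cases hL : Even L.length
      · rw [hL.neg_one_pow, one_smul, map_add, avgAll, prod_avg_mon _ hL]
        split_ifs with h
        · have h1 : mon L ∈ Submodule.span ℝ {(1 : Cl p q)} := by
            rcases mon_eq_one_of_even_count (L := L) fun i => h i (by simp) with h | h <;> rw [h]
            · exact Submodule.mem_span_singleton_self _
            · exact Submodule.neg_mem _ (Submodule.mem_span_singleton_self _)
          exact Submodule.add_mem _ h1 h1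
        · simp
      · rw [(Nat.not_even_iff_odd.1 hL).neg_one_pow]
        simp
    | zero => simp
    | add a b _ _ ha hb =>
      have := Submodule.add_mem _ ha hb
      rw [← map_add] at this
      convert this using 2
      rw [map_add]
      abel
    | smul r a _ ha =>
      have := Submodule.smul_mem _ r ha
      rwa [← map_smul, smul_add, ← map_smul] at this
  have h := hspan x
  rw [hx, ← two_smul ℝ, map_smul] at h
  have h' := Submodule.smul_mem _ (2⁻¹ : ℝ) h
  rw [smul_smul, inv_mul_cancel₀ two_ne_zero, one_smul] at h'
  obtain ⟨r, hr⟩ := Submodule.mem_span_singleton.1 h'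
  exact ⟨r, hr.symm⟩

end Cl

/-! ### Logarithms of positive definite pseudo-orthogonal matrices -/

/-- A positive definite `P` that preserves the form `S` has a symmetric logarithm in the Lie algebra
of the isometry group of `S`. -/
theorem Matrix.PosDef.exists_log {n : Type*} [Fintype n] [DecidableEq n] {P : Matrix n n ℝ}
    (hP : P.PosDef) {S : Matrix n n ℝ} (hS : Pᵀ * S * P = S) :
    ∃ A : Matrix n n ℝ, Aᵀ = A ∧ NormedSpace.exp A = P ∧ S * A = -(A * S) := by
  set U : Matrix n n ℝ := (hP.1.eigenvectorUnitary : Matrix n n ℝ)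
  set d : n → ℝ := hP.1.eigenvalues
  have hd : ∀ i, 0 < d i := hP.eigenvalues_pos
  have hU1 : Uᵀ * U = 1 := Unitary.coe_star_mul_self hP.1.eigenvectorUnitary
  have hU2 : U * Uᵀ = 1 := Unitary.coe_mul_star_self hP.1.eigenvectorUnitary
  have hspec : P = U * Matrix.diagonal d * Uᵀ := hP.1.spectral_theorem
  have hPt : Pᵀ = P := hP.1
  have hinv : U⁻¹ = Uᵀ := Matrix.inv_eq_right_inv hU2
  refine ⟨U * Matrix.diagonal (fun i => Real.log (d i)) * Uᵀ, ?_, ?_, ?_⟩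
  · simp [Matrix.transpose_mul, Matrix.mul_assoc]
  · rw [← hinv, Matrix.exp_conj _ _ (IsUnit.of_mul_eq_one _ hU2), Matrix.exp_diagonal, hinv, hspec]
    congr 3
    ext i
    rw [Pi.coe_exp, ← Real.exp_eq_exp_ℝ, Real.exp_log (hd i)]
  · -- In the eigenbasis the invariance of `S` reads `d i * W i j * d j = W i j`.
    set W := Uᵀ * S * U with hW
    have hSW : S = U * W * Uᵀ := by
      rw [hW, Matrix.mul_assoc, Matrix.mul_assoc, Matrix.mul_assoc, hU2, Matrix.mul_one,
        ← Matrix.mul_assoc, hU2, Matrix.one_mul]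
    have hcancel : ∀ X Y : Matrix n n ℝ, U * X * Uᵀ * (U * Y * Uᵀ) = U * (X * Y) * Uᵀ := by
      intro X Y
      rw [show U * X * Uᵀ * (U * Y * Uᵀ) = U * X * (Uᵀ * U) * Y * Uᵀ by
        simp only [Matrix.mul_assoc], hU1, Matrix.mul_one, Matrix.mul_assoc U X Y]
    have hdW : Matrix.diagonal d * W * Matrix.diagonal d = W := by
      have h := hS
      rw [hPt, hspec, hSW, hcancel, hcancel] at h
      have h2 := congrArg (fun X => Uᵀ * X * U) h
      have h3 : ∀ X : Matrix n n ℝ, Uᵀ * (U * X * Uᵀ) * U = X := by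
        intro X
        rw [show Uᵀ * (U * X * Uᵀ) * U = Uᵀ * U * X * (Uᵀ * U) by simp only [Matrix.mul_assoc],
          hU1, Matrix.mul_one, Matrix.one_mul]
      simpa only [h3] using h2
    rw [hSW, hcancel, hcancel, ← Matrix.neg_mul, ← Matrix.mul_neg]
    congr 2
    ext i j
    rw [Matrix.mul_diagonal, Matrix.neg_apply, Matrix.diagonal_mul]
    have hij : d i * W i j * d j = W i j := by
      have h := congrFun (congrFun hdW i) j
      rwa [Matrix.mul_diagonal, Matrix.diagonal_mul] at h
    by_cases h0 : W i j = 0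
    · simp [h0]
    · have h1 : d i * d j = 1 := by
        refine mul_right_cancel₀ h0 ?_
        rw [one_mul]
        linarith
      have h2 : Real.log (d i) + Real.log (d j) = 0 := by
        rw [← Real.log_mul (hd i).ne' (hd j).ne', h1, Real.log_one]
      linear_combination W i j * h2

theorem indefiniteDiagonal_eq_diagonal_sigSign (p q : ℕ) :
    LieAlgebra.Orthogonal.indefiniteDiagonal (Fin p) (Fin q) ℝ = Matrix.diagonal (sigSign p q) :=
  rfl

/-- A positive definite `P` in `SO(p, q)` is the exponential of a symmetric matrix whose diagonal
blocks vanish, which is what the sign condition says entrywise. -/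
theorem exists_log_of_mem_specialIndefinite {p q : ℕ}
    {P : Matrix (Fin p ⊕ Fin q) (Fin p ⊕ Fin q) ℝ} (hP : P ∈ specialIndefinite p q)
    (hPpos : P.PosDef) : ∃ A : Matrix (Fin p ⊕ Fin q) (Fin p ⊕ Fin q) ℝ,
      (∀ i j, A j i = A i j) ∧ NormedSpace.exp A = P ∧
        ∀ i j, sigSign p q i * A i j = -(A i j * sigSign p q j) := by
  obtain ⟨A, h1, h2, h3⟩ := hPpos.exists_log hP.1
  rw [indefiniteDiagonal_eq_diagonal_sigSign] at h3
  refine ⟨A, fun i j => congrFun (congrFun h1 i) j, h2, fun i j => ?_⟩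
  have h := congrFun (congrFun h3 i) j
  rwa [Matrix.diagonal_mul, Matrix.neg_apply, Matrix.mul_diagonal] at h

/-! ### Bivectors -/

namespace Cl

variable {p q : ℕ}

/-- The bivector whose adjoint action on one-vectors is `A`, when `A` is in the Lie algebra
of `SO(p, q)`. -/
def bivector (A : Matrix (Fin p ⊕ Fin q) (Fin p ⊕ Fin q) ℝ) : Cl p q :=
  (4⁻¹ : ℝ) • ∑ i, ∑ j, (A i j * sigSign p q j) • (gen i * gen j)

theorem gen_mul_add_swap (i j : Fin p ⊕ Fin q) :
    gen i * gen j + gen j * gen i = (if i = j then 2 * sigSign p q i else 0) • (1 : Cl p q) := by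
  split_ifs with h
  · subst h
    rw [gen_mul_self, ← add_smul, two_mul]
  · rw [gen_mul_gen h, zero_smul, neg_add_cancel]

theorem gen_mul_gen_comm (i j k : Fin p ⊕ Fin q) :
    gen i * gen j * gen k - gen k * (gen i * gen j) =
      (if j = k then 2 * sigSign p q j else 0) • gen i -
        (if i = k then 2 * sigSign p q i else 0) • gen j := by
  have h : gen i * gen j * gen k - gen k * (gen i * gen j) =
      gen i * (gen j * gen k + gen k * gen j) - (gen i * gen k + gen k * gen i) * gen j := by
    noncomm_ring
  rw [h, gen_mul_add_swap, gen_mul_add_swap, mul_smul_comm, mul_one, smul_mul_assoc, one_mul]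

theorem bivector_comm_gen {A : Matrix (Fin p ⊕ Fin q) (Fin p ⊕ Fin q) ℝ}
    (hsymm : ∀ i j, A j i = A i j) (hsign : ∀ i j, sigSign p q i * A i j = -(A i j * sigSign p q j))
    (k : Fin p ⊕ Fin q) :
    bivector A * gen k - gen k * bivector A = ∑ i, A i k • gen i := by
  rw [bivector, smul_mul_assoc, mul_smul_comm, ← smul_sub]
  simp only [Finset.sum_mul, Finset.mul_sum, ← Finset.sum_sub_distrib, smul_mul_assoc,
    mul_smul_comm, ← smul_sub, gen_mul_gen_comm]
  simp only [smul_sub, Finset.sum_sub_distrib, smul_smul, smul_ite, smul_zero, ite_smul, zero_smul,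
    Finset.sum_ite_eq', Finset.mem_univ, if_true]
  rw [Finset.sum_comm (f := fun i j => if i = k then
    (A i j * sigSign p q j * (2 * sigSign p q i)) • (gen j : Cl p q) else 0)]
  simp only [Finset.sum_ite_eq', Finset.mem_univ, if_true, ← Finset.sum_sub_distrib, ← sub_smul,
    Finset.smul_sum, smul_smul]
  refine Finset.sum_congr rfl fun i _ => ?_
  congr 1
  rw [hsymm i k]
  linear_combination A i k * sigSign_mul_self k - (2⁻¹ * sigSign p q k) * hsign i k

theorem bivector_comm_ι {A : Matrix (Fin p ⊕ Fin q) (Fin p ⊕ Fin q) ℝ}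
    (hsymm : ∀ i j, A j i = A i j) (hsign : ∀ i j, sigSign p q i * A i j = -(A i j * sigSign p q j))
    (v : Fin p ⊕ Fin q → ℝ) :
    bivector A * CliffordAlgebra.ι (sigForm p q) v -
      CliffordAlgebra.ι (sigForm p q) v * bivector A =
        CliffordAlgebra.ι (sigForm p q) (A *ᵥ v) := by
  rw [ι_eq_sum_gen, ι_eq_sum_gen, Finset.mul_sum, Finset.sum_mul, ← Finset.sum_sub_distrib]
  simp only [mul_smul_comm, smul_mul_assoc, ← smul_sub, bivector_comm_gen hsymm hsign,
    Matrix.mulVec, dotProduct, Finset.sum_smul, Finset.smul_sum, smul_smul]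
  rw [Finset.sum_comm]
  simp only [mul_comm]

theorem involute_bivector (A : Matrix (Fin p ⊕ Fin q) (Fin p ⊕ Fin q) ℝ) :
    CliffordAlgebra.involute (bivector A) = bivector A := by
  simp [bivector, involute_gen]

/-- Clifford conjugation as a linear map. -/
def ccLinear : Cl p q →ₗ[ℝ] Cl p q :=
  CliffordAlgebra.reverse ∘ₗ CliffordAlgebra.involute.toLinearMap

theorem ccLinear_apply (x : Cl p q) : ccLinear x = cc x := rfl

theorem cc_bivector {A : Matrix (Fin p ⊕ Fin q) (Fin p ⊕ Fin q) ℝ}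
    (hsymm : ∀ i j, A j i = A i j)
    (hsign : ∀ i j, sigSign p q i * A i j = -(A i j * sigSign p q j)) :
    cc (bivector A) = -bivector A := by
  have h : ∀ i j, cc (gen i * gen j : Cl p q) = gen j * gen i := by
    intro i j
    simp [cc_mul, cc_gen]
  have h2 : cc (bivector A) = (4⁻¹ : ℝ) • ∑ i, ∑ j, (A i j * sigSign p q j) • (gen j * gen i) := by
    simp only [← ccLinear_apply, bivector, map_smul, map_sum]
    simp only [ccLinear_apply, h]
  rw [h2, Finset.sum_comm, bivector, ← smul_neg, ← Finset.sum_neg_distrib]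
  congr 1
  refine Finset.sum_congr rfl fun i _ => ?_
  rw [← Finset.sum_neg_distrib]
  refine Finset.sum_congr rfl fun j _ => ?_
  rw [← neg_smul, hsymm, mul_comm, hsign]

theorem cc_pow (x : Cl p q) (k : ℕ) : cc (x ^ k) = cc x ^ k := by
  induction k with
  | zero => simp [cc]
  | succ k ih => rw [pow_succ, cc_mul, ih, pow_succ']

theorem cc_algExp (x : Cl p q) : cc (algExp x) = algExp (cc x) :=
  map_algExp_eq ccLinear LinearMap.id x (cc x) fun k => cc_pow x k

theorem involute_algExp {x : Cl p q} (hx : CliffordAlgebra.involute x = x) :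
    CliffordAlgebra.involute (algExp x) = algExp x :=
  map_algExp_eq CliffordAlgebra.involute.toLinearMap LinearMap.id x x fun k => by
    rw [AlgHom.toLinearMap_apply, map_pow, hx, LinearMap.id_apply]

theorem algExp_toLin' (A : Matrix (Fin p ⊕ Fin q) (Fin p ⊕ Fin q) ℝ) (v : Fin p ⊕ Fin q → ℝ) :
    algExp (A := Module.End ℝ (Fin p ⊕ Fin q → ℝ)) (Matrix.toLin' A) v =
      NormedSpace.exp A *ᵥ v := by
  have h := map_algExp_eq (A := Matrix (Fin p ⊕ Fin q) (Fin p ⊕ Fin q) ℝ)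
    (A' := Module.End ℝ (Fin p ⊕ Fin q → ℝ)) (F := Module.End ℝ (Fin p ⊕ Fin q → ℝ))
    (Matrix.toLin' : Matrix (Fin p ⊕ Fin q) (Fin p ⊕ Fin q) ℝ ≃ₗ[ℝ] _).toLinearMap
    LinearMap.id A (Matrix.toLin' A) fun k => Matrix.toLin'_pow A k
  rw [LinearMap.id_apply] at h
  rw [← h, algExp_matrix]
  rfl

/-- The exponential of a bivector is in the spin group and acts on one-vectors as the exponential
of the corresponding element of the Lie algebra of `SO(p, q)`. -/
theorem algExp_bivector_mul_ι_mul_cc {A : Matrix (Fin p ⊕ Fin q) (Fin p ⊕ Fin q) ℝ}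
    (hsymm : ∀ i j, A j i = A i j) (hsign : ∀ i j, sigSign p q i * A i j = -(A i j * sigSign p q j))
    (v : Fin p ⊕ Fin q → ℝ) :
    algExp (bivector A) * CliffordAlgebra.ι (sigForm p q) v * cc (algExp (bivector A)) =
      CliffordAlgebra.ι (sigForm p q) (NormedSpace.exp A *ᵥ v) := by
  rw [cc_algExp, cc_bivector hsymm hsign, ← algExp_toLin']
  exact algExp_mul_mul_algExp_neg (bivector A) (CliffordAlgebra.ι (sigForm p q))
    (Matrix.toLin' A) (fun v => by rw [bivector_comm_ι hsymm hsign, Matrix.toLin'_apply]) v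

theorem algExp_bivector_mem_spinSet {A : Matrix (Fin p ⊕ Fin q) (Fin p ⊕ Fin q) ℝ}
    (hsymm : ∀ i j, A j i = A i j)
    (hsign : ∀ i j, sigSign p q i * A i j = -(A i j * sigSign p q j)) :
    algExp (bivector A) ∈ spinSet p q := by
  refine ⟨involute_algExp (involute_bivector A), ?_,
    fun v => ⟨_, algExp_bivector_mul_ι_mul_cc hsymm hsign v⟩⟩
  rw [cc_algExp, cc_bivector hsymm hsign, algExp_mul_neg]

theorem bivector_smul (t : ℝ) (A : Matrix (Fin p ⊕ Fin q) (Fin p ⊕ Fin q) ℝ) :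
    bivector (t • A) = t • bivector A := by
  simp only [bivector, Matrix.smul_apply, smul_eq_mul, mul_assoc, mul_smul, ← Finset.smul_sum]
  rw [smul_comm]

end Cl

namespace OneVectorBasis

variable {K : Type} [Ring K] [Algebra ℝ K] {p q m : ℕ}

theorem rep_gen (B : OneVectorBasis K p q m) (i : Fin p ⊕ Fin q) :
    B.rep (Cl.gen i) = B.vec i := by
  rw [Cl.gen, rep_ι, comb, Fintype.linearCombination_apply_single, one_smul]

/-! ### Uniqueness up to sign -/

/-- Averaging is invisible in the representation on elements whose image commutes with all
one-vectors. -/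
theorem rep_avgAll (B : OneVectorBasis K p q m) {x : Cl p q}
    (hx : ∀ i, B.rep x * B.vec i = B.vec i * B.rep x) : B.rep (Cl.avgAll x) = B.rep x := by
  unfold Cl.avgAll
  induction (Finset.univ : Finset (Fin p ⊕ Fin q)).toList with
  | nil => simp
  | cons i J ih =>
    rw [List.map_cons, List.prod_cons, Module.End.mul_apply, Cl.avg_apply, map_smul, map_add,
      map_smul, map_mul, map_mul, rep_gen, ih, hx, ← mul_assoc, vec_sq, smul_mul_assoc, one_mul,
      smul_smul, Cl.sigSign_mul_self, one_smul, ← two_smul ℝ, smul_smul, inv_mul_cancel₀ two_ne_zero,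
      one_smul]

/-- The kernel of the spin covering is `{1, -1}`, at the level of the matrices. -/
theorem rep_eq_one_or_neg_one [Nontrivial K] [NeZero m] [IsStablyFiniteRing K]
    (B : OneVectorBasis K p q m) {x : Cl p q} (heven : CliffordAlgebra.involute x = x)
    (hx : ∀ i, B.rep x * B.vec i = B.vec i * B.rep x) (hcc : B.rep x * B.rep (Cl.cc x) = 1) :
    B.rep x = 1 ∨ B.rep x = -1 := by
  have hcc' : B.rep (Cl.cc x) * B.rep x = 1 := mul_eq_one_comm.1 hcc
  have hx' : ∀ i, B.rep (Cl.cc x) * B.vec i = B.vec i * B.rep (Cl.cc x) := by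
    intro i
    calc B.rep (Cl.cc x) * B.vec i
        = B.rep (Cl.cc x) * (B.vec i * B.rep x) * B.rep (Cl.cc x) := by
          rw [mul_assoc, mul_assoc, hcc, mul_one]
      _ = B.vec i * B.rep (Cl.cc x) := by
          rw [← hx, ← mul_assoc, hcc', one_mul]
  obtain ⟨r, hr⟩ := Cl.exists_avgAll_eq_smul_one heven
  have h1 : B.rep x = r • 1 := by
    rw [← B.rep_avgAll hx, hr, map_smul, map_one]
  -- Averaging commutes with conjugation, so `x` and `x^cc` have the same scalar part.
  have h2 : B.rep (Cl.cc x) = r • 1 := by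
    rw [← B.rep_avgAll hx', Cl.avgAll_cc, hr, ← Cl.ccLinear_apply, map_smul, Cl.ccLinear_apply]
    simp [Cl.cc]
  rw [h1, h2, smul_mul_smul_comm, one_mul] at hcc
  have h3 : r * r = 1 := by
    have h : (r * r - 1) • (1 : Matrix (Fin m) (Fin m) K) = 0 := by
      rw [sub_smul, hcc, one_smul, sub_self]
    rcases smul_eq_zero.1 h with h | h
    · linarith
    · exact absurd h one_ne_zero
  rcases mul_self_eq_one_iff.1 h3 with h | h <;> simp [h1, h]

section Topology

variable [TopologicalSpace K]

theorem conj_mul [IsStablyFiniteRing K] (B : OneVectorBasis K p q m) (Y : B.spinPlus) :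
    B.conj Y * Y = 1 :=
  mul_eq_one_comm.1 (B.mul_conj Y)

theorem eq_or_eq_neg_of_covering_eq [Nontrivial K] [NeZero m] [IsStablyFiniteRing K]
    (B : OneVectorBasis K p q m) {Y₁ Y₂ : B.spinPlus} (h : B.covering Y₁ = B.covering Y₂) :
    (Y₁ : Matrix (Fin m) (Fin m) K) = Y₂ ∨ (Y₁ : Matrix (Fin m) (Fin m) K) = -Y₂ := by
  have hact : B.spinAct Y₁ = B.spinAct Y₂ := (LinearMap.toMatrix B.basis B.basis).injective h
  obtain ⟨x₁, hx₁, hY₁⟩ := B.exists_lift Y₁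
  obtain ⟨x₂, hx₂, hY₂⟩ := B.exists_lift Y₂
  have hc₁ := B.conj_eq Y₁ x₁ hx₁ hY₁
  have hc₂ := B.conj_eq Y₂ x₂ hx₂ hY₂
  have hcomm : ∀ i, B.conj Y₂ * Y₁ * B.vec i = B.vec i * (B.conj Y₂ * Y₁) := by
    intro i
    have hi : (Y₁ : Matrix (Fin m) (Fin m) K) * B.vec i * B.conj Y₁ = Y₂ * B.vec i * B.conj Y₂ :=
      congrArg Subtype.val (LinearMap.congr_fun hact ⟨B.vec i, Submodule.subset_span ⟨i, rfl⟩⟩)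
    calc B.conj Y₂ * Y₁ * B.vec i = B.conj Y₂ * (Y₁ * B.vec i * B.conj Y₁) * Y₁ := by
          simp only [mul_assoc, B.conj_mul, mul_one]
      _ = B.conj Y₂ * Y₂ * B.vec i * (B.conj Y₂ * Y₁) := by
          rw [hi]
          simp only [mul_assoc]
      _ = B.vec i * (B.conj Y₂ * Y₁) := by rw [B.conj_mul, one_mul]
  have hrep : B.rep (Cl.cc x₂ * x₁) = B.conj Y₂ * Y₁ := by rw [map_mul, hY₁, ← hc₂]
  have hcccc : Cl.cc (Cl.cc x₂) = x₂ := by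
    simp [Cl.cc, ← CliffordAlgebra.reverse_involute_commute.eq]
  have heven : CliffordAlgebra.involute (Cl.cc x₂ * x₁) = Cl.cc x₂ * x₁ := by
    rw [map_mul, hx₁.1]
    simp [Cl.cc, ← CliffordAlgebra.reverse_involute_commute.eq, hx₂.1]
  have hcc : B.rep (Cl.cc x₂ * x₁) * B.rep (Cl.cc (Cl.cc x₂ * x₁)) = 1 := by
    rw [Cl.cc_mul, hcccc, map_mul, map_mul, hY₁, ← hc₂, ← hc₁, hY₂, mul_assoc,
      ← mul_assoc _ (B.conj Y₁), B.mul_conj, one_mul, B.conj_mul]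
  have hY : (Y₁ : Matrix (Fin m) (Fin m) K) = Y₂ * (B.conj Y₂ * Y₁) := by
    rw [← mul_assoc, B.mul_conj, one_mul]
  rcases B.rep_eq_one_or_neg_one heven (by rwa [hrep]) hcc with h | h <;> rw [hrep] at h <;>
    rw [h] at hY
  · exact .inl (by rw [hY, mul_one])
  · exact .inr (by rw [hY, mul_neg, mul_one])

/-! ### Existence of a positive definite lift -/

/-- The path `t ↦ exp (t x)` joins the exponential of a bivector to the identity. -/
theorem rep_algExp_bivector_mem_spinPlus [IsTopologicalRing K] [ContinuousSMul ℝ K]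
    (B : OneVectorBasis K p q m) {A : Matrix (Fin p ⊕ Fin q) (Fin p ⊕ Fin q) ℝ}
    (hsymm : ∀ i j, A j i = A i j)
    (hsign : ∀ i j, sigSign p q i * A i j = -(A i j * sigSign p q j)) :
    B.rep (algExp (Cl.bivector A)) ∈ B.spinPlus := by
  have hcont : Continuous fun t : ℝ => B.rep (algExp (t • Cl.bivector A)) :=
    continuous_map_algExp_smul (F := Matrix (Fin m) (Fin m) K) B.rep.toLinearMap (Cl.bivector A)
  have hsub : Set.range (fun t : ℝ => B.rep (algExp (t • Cl.bivector A))) ⊆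
      B.rep '' Cl.spinSet p q := by
    rintro _ ⟨t, rfl⟩
    refine ⟨_, ?_, rfl⟩
    rw [← Cl.bivector_smul]
    refine Cl.algExp_bivector_mem_spinSet (fun i j => ?_) fun i j => ?_
    · rw [Matrix.smul_apply, Matrix.smul_apply, hsymm]
    · rw [Matrix.smul_apply, smul_eq_mul]
      linear_combination t * hsign i j
  exact (isPreconnected_range hcont).subset_connectedComponentIn
    ⟨0, by simp [algExp_zero]⟩ hsub ⟨1, by simp⟩

/-- It suffices to find the covering matrix in the abstract Clifford algebra. -/
theorem covering_eq [Nontrivial K] [NeZero m] [IsStablyFiniteRing K]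
    (B : OneVectorBasis K p q m) (Y : B.spinPlus) {x : Cl p q} (hx : x ∈ Cl.spinSet p q)
    (hxY : B.rep x = Y) {P : Matrix (Fin p ⊕ Fin q) (Fin p ⊕ Fin q) ℝ}
    (hP : ∀ v, x * CliffordAlgebra.ι (sigForm p q) v * Cl.cc x =
      CliffordAlgebra.ι (sigForm p q) (P *ᵥ v)) : B.covering Y = P := by
  refine (Matrix.toLin B.basis B.basis).injective ?_
  rw [covering, Matrix.toLin_toMatrix]
  refine B.basis.ext fun j => Subtype.ext ?_
  have hj : ∀ i, (B.basis i : Matrix (Fin m) (Fin m) K) = B.vec i := fun i =>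
    congrArg Subtype.val (Module.Basis.span_apply B.linearIndependent i)
  rw [Matrix.toLin_self]
  have h := congrArg B.rep (hP (Pi.single j 1))
  rw [map_mul, map_mul, rep_ι, hxY, ← B.conj_eq Y x hx hxY, comb,
    Fintype.linearCombination_apply_single, one_smul, rep_ι, comb, Fintype.linearCombination_apply,
    Matrix.mulVec_single_one] at h
  change (Y : Matrix (Fin m) (Fin m) K) * (B.basis j : Matrix (Fin m) (Fin m) K) * B.conj Y = _
  rw [hj, h]
  simp [hj]

end Topology

section Star

variable [StarRing K]

/-- The signs in `BP1` are forced: a one-vector with square `I` is Hermitian and one with square `-I`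
is skew-Hermitian, because `-I` is not of the form `M* M`. -/
theorem conjTranspose_vec (B : OneVectorBasis K p q m)
    (hK : ∀ M : Matrix (Fin m) (Fin m) K, Mᴴ * M ≠ -1) (hB : B.BP1) (i : Fin p ⊕ Fin q) :
    (B.vec i)ᴴ = sigSign p q i • B.vec i := by
  rcases i with i | i <;> rcases hB _ with h | h
  · simpa [sigSign] using h
  · exact absurd (by rw [h, neg_mul, B.sq_pos]) (hK (B.vec (.inl i)))
  · exact absurd (by rw [h, B.sq_neg]) (hK (B.vec (.inr i)))
  · simpa [sigSign] using h

theorem conjTranspose_rep_bivector [StarModule ℝ K] (B : OneVectorBasis K p q m)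
    (hV : ∀ i, (B.vec i)ᴴ = sigSign p q i • B.vec i)
    {A : Matrix (Fin p ⊕ Fin q) (Fin p ⊕ Fin q) ℝ} (hsymm : ∀ i j, A j i = A i j) :
    (B.rep (Cl.bivector A))ᴴ = B.rep (Cl.bivector A) := by
  have h : B.rep (Cl.bivector A) =
      (4⁻¹ : ℝ) • ∑ i, ∑ j, (A i j * sigSign p q j) • (B.vec i * B.vec j) := by
    simp only [Cl.bivector, map_smul, map_sum, map_mul, rep_gen]
  rw [h, Matrix.conjTranspose_smul, star_trivial]
  congr 1
  simp only [Matrix.conjTranspose_sum, Matrix.conjTranspose_smul, Matrix.conjTranspose_mul, hV,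
    star_trivial, smul_mul_smul_comm, smul_smul]
  rw [Finset.sum_comm]
  refine Finset.sum_congr rfl fun i _ => Finset.sum_congr rfl fun j _ => ?_
  congr 1
  rw [hsymm]
  linear_combination A i j * sigSign p q j * Cl.sigSign_mul_self i

/-- The exponential of an element with Hermitian image is represented by `Z* Z`, where `Z` is
the image of the exponential of one half of the element. -/
theorem exists_rep_algExp_eq [StarModule ℝ K] (B : OneVectorBasis K p q m) {x : Cl p q}
    (hx : (B.rep x)ᴴ = B.rep x) :
    ∃ Z W : Matrix (Fin m) (Fin m) K, W * Z = 1 ∧ B.rep (algExp x) = Zᴴ * Z := by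
  set y : Cl p q := (2⁻¹ : ℝ) • x with hy
  have hyx : x = y + y := by rw [hy, ← two_smul ℝ, smul_smul, mul_inv_cancel₀ two_ne_zero, one_smul]
  have hyH : (B.rep y)ᴴ = B.rep y := by
    rw [hy, map_smul, Matrix.conjTranspose_smul, star_trivial, hx]
  have hexp : (B.rep (algExp y))ᴴ = B.rep (algExp y) :=
    map_algExp_eq (F := Matrix (Fin m) (Fin m) K)
      { toFun := fun a => (B.rep a)ᴴ
        map_add' := fun a b => by rw [map_add, Matrix.conjTranspose_add]
        map_smul' := fun r a => by
          rw [map_smul, Matrix.conjTranspose_smul, star_trivial, RingHom.id_apply] }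
      B.rep.toLinearMap y y fun k => by
        change (B.rep (y ^ k))ᴴ = B.rep (y ^ k)
        rw [map_pow, Matrix.conjTranspose_pow, hyH]
  refine ⟨B.rep (algExp y), B.rep (algExp (-y)), ?_, ?_⟩
  · rw [← map_mul]
    have h := algExp_mul_neg (-y)
    rw [neg_neg] at h
    rw [h, map_one]
  · rw [hexp, ← map_mul, hyx, algExp_add_of_commute (Commute.refl y)]

/-- The lifting theorem over any suitable algebra `K`, for an abstract notion of positivity
that holds for `Z* Z` with `Z` invertible and is never shared by `Y` and `-Y`. -/
theorem existsUnique_posDef_lift [Nontrivial K] [NeZero m] [IsStablyFiniteRing K] [StarModule ℝ K]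
    [TopologicalSpace K] [IsTopologicalRing K] [ContinuousSMul ℝ K]
    {P : Matrix (Fin p ⊕ Fin q) (Fin p ⊕ Fin q) ℝ} (hP : P ∈ specialIndefinite p q)
    (hPpos : P.PosDef) {Pos : Matrix (Fin m) (Fin m) K → Prop}
    (hpos : ∀ Z W : Matrix (Fin m) (Fin m) K, W * Z = 1 → Pos (Zᴴ * Z))
    (hneg : ∀ Y : Matrix (Fin m) (Fin m) K, Pos Y → ¬ Pos (-Y))
    (hK : ∀ M : Matrix (Fin m) (Fin m) K, Mᴴ * M ≠ -1) (B : OneVectorBasis K p q m) (hB : B.BP1) :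
    ∃! Y : B.spinPlus, Pos Y ∧ B.covering Y = P := by
  obtain ⟨A, hsymm, hexp, hsign⟩ := exists_log_of_mem_specialIndefinite hP hPpos
  have hmem := B.rep_algExp_bivector_mem_spinPlus hsymm hsign
  have hcov : B.covering ⟨_, hmem⟩ = P :=
    B.covering_eq ⟨_, hmem⟩ (Cl.algExp_bivector_mem_spinSet hsymm hsign) rfl fun v => by
      rw [Cl.algExp_bivector_mul_ι_mul_cc hsymm hsign, hexp]
  obtain ⟨Z, W, hWZ, hZ⟩ := B.exists_rep_algExp_eq
    (B.conjTranspose_rep_bivector (B.conjTranspose_vec hK hB) hsymm)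
  have hYpos : Pos (B.rep (algExp (Cl.bivector A))) := hZ ▸ hpos Z W hWZ
  refine ⟨⟨_, hmem⟩, ⟨hYpos, hcov⟩, fun Y hY => Subtype.ext ?_⟩
  rcases B.eq_or_eq_neg_of_covering_eq (hY.2.trans hcov.symm) with h | h
  · exact h
  · exact absurd (h ▸ hY.1) (hneg _ hYpos)

end Star

end OneVectorBasis

/-! ### Positivity over the reals, the complex numbers and the quaternions -/

theorem Matrix.PosDef.not_posDef_neg {R : Type*} [RCLike R] {m : ℕ} [NeZero m]
    {Y : Matrix (Fin m) (Fin m) R} (hY : Y.PosDef) : ¬ (-Y).PosDef := by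
  intro h
  have h1 := hY.diag_pos (i := 0)
  have h2 := h.diag_pos (i := 0)
  rw [Matrix.neg_apply, Left.neg_pos_iff] at h2
  exact lt_asymm h1 h2

theorem Matrix.conjTranspose_mul_self_ne_neg_one {R : Type*} [RCLike R] {m : ℕ} [NeZero m]
    (M : Matrix (Fin m) (Fin m) R) : Mᴴ * M ≠ -1 := by
  intro h
  have h1 := (Matrix.posSemidef_conjTranspose_mul_self M).diag_nonneg (i := 0)
  rw [h, Matrix.neg_apply, Matrix.one_apply_eq, Left.nonneg_neg_iff] at h1
  exact absurd h1 (not_le_of_gt zero_lt_one)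

theorem Matrix.posDef_conjTranspose_mul_self_of_mul_eq_one {R : Type*} [RCLike R] {m : ℕ}
    (Z W : Matrix (Fin m) (Fin m) R) (h : W * Z = 1) : (Zᴴ * Z).PosDef :=
  Matrix.PosDef.conjTranspose_mul_self Z fun a b hab => by
    have h' := congrArg (W *ᵥ ·) hab
    simpa [Matrix.mulVec_mulVec, h] using h'

theorem re_star_dotProduct_self {m : ℕ} (x : Fin m → ℍ[ℝ]) :
    (star x ⬝ᵥ x).re = ∑ i, Quaternion.normSq (x i) := by
  have h : star x ⬝ᵥ x = ((∑ i, Quaternion.normSq (x i) : ℝ) : ℍ[ℝ]) := by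
    simp only [dotProduct, Pi.star_apply, Quaternion.star_mul_self]
    exact (map_sum (algebraMap ℝ ℍ[ℝ]) _ _).symm
  rw [h, Quaternion.re_coe]

theorem quaternionPosDef_conjTranspose_mul_self {m : ℕ} (Z W : Matrix (Fin m) (Fin m) ℍ[ℝ])
    (h : W * Z = 1) : QuaternionPosDef (Zᴴ * Z) := by
  refine ⟨Matrix.isHermitian_conjTranspose_mul_self Z, fun x hx => ?_⟩
  have hZx : Z *ᵥ x ≠ 0 := by
    intro h0
    have h' := congrArg (W *ᵥ ·) h0
    exact hx (by simpa [Matrix.mulVec_mulVec, h] using h')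
  obtain ⟨i, hi⟩ := Function.ne_iff.1 hZx
  rw [← Matrix.mulVec_mulVec, Matrix.dotProduct_mulVec, ← Matrix.star_mulVec,
    re_star_dotProduct_self]
  exact Finset.sum_pos' (fun j _ => Quaternion.normSq_nonneg)
    ⟨i, Finset.mem_univ _, lt_of_le_of_ne Quaternion.normSq_nonneg
      fun h0 => hi (Quaternion.normSq_eq_zero.1 h0.symm)⟩

theorem QuaternionPosDef.not_neg {m : ℕ} [NeZero m] {Y : Matrix (Fin m) (Fin m) ℍ[ℝ]}
    (hY : QuaternionPosDef Y) : ¬ QuaternionPosDef (-Y) := by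
  intro h
  have h1 := hY.2 1 one_ne_zero
  have h2 := h.2 1 one_ne_zero
  rw [Matrix.neg_mulVec, dotProduct_neg, Quaternion.re_neg] at h2
  linarith

theorem quaternion_conjTranspose_mul_self_ne_neg_one {m : ℕ} [NeZero m]
    (M : Matrix (Fin m) (Fin m) ℍ[ℝ]) : Mᴴ * M ≠ -1 := by
  intro h
  have h1 : ((Mᴴ * M) 0 0).re = ∑ i, Quaternion.normSq (M i 0) := re_star_dotProduct_self (M.col 0)
  rw [h, Matrix.neg_apply, Matrix.one_apply_eq, Quaternion.re_neg, Quaternion.re_one] at h1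
  have h2 : 0 ≤ ∑ i, Quaternion.normSq (M i 0) :=
    Finset.sum_nonneg fun i _ => Quaternion.normSq_nonneg
  linarith

end

theorem proposition2p1 (p q m : ℕ) [NeZero m] (P : Matrix (Fin p ⊕ Fin q) (Fin p ⊕ Fin q) ℝ)
    (hP : P ∈ specialIndefinitePlus p q) (hPpos : P.PosDef) :
    (∀ B : OneVectorBasis ℝ p q m, B.BP1 → B.BP2 →
      ∃! Y : B.spinPlus, (Y : Matrix (Fin m) (Fin m) ℝ).PosDef ∧ B.covering Y = P) ∧
    (∀ B : OneVectorBasis ℂ p q m, B.BP1 → B.BP2 →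
      ∃! Y : B.spinPlus, (Y : Matrix (Fin m) (Fin m) ℂ).PosDef ∧ B.covering Y = P) ∧
    (∀ B : OneVectorBasis ℍ[ℝ] p q m, B.BP1 → B.BP2Quaternion →
      ∃! Y : B.spinPlus, QuaternionPosDef (Y : Matrix (Fin m) (Fin m) ℍ[ℝ]) ∧
        B.covering Y = P) := by
  have hP' : P ∈ specialIndefinite p q := connectedComponentIn_subset _ _ hP
  have : StarModule ℝ ℍ[ℝ] := ⟨Quaternion.star_smul⟩
  exact ⟨fun B hB _ => B.existsUnique_posDef_lift hP' hPpos
      Matrix.posDef_conjTranspose_mul_self_of_mul_eq_one (fun _ h => h.not_posDef_neg)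
      Matrix.conjTranspose_mul_self_ne_neg_one hB,
    fun B hB _ => B.existsUnique_posDef_lift hP' hPpos
      Matrix.posDef_conjTranspose_mul_self_of_mul_eq_one (fun _ h => h.not_posDef_neg)
      Matrix.conjTranspose_mul_self_ne_neg_one hB,
    fun B hB _ => B.existsUnique_posDef_lift hP' hPpos
      quaternionPosDef_conjTranspose_mul_self (fun _ h => h.not_neg)
      quaternion_conjTranspose_mul_self_ne_neg_one hB⟩
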